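/- Let $2\le k\le n$ and let $\mathcal{B}_n^k$ be the $S_n$-invariant building set on $[n]=\{1,\dots,n\}$ consisting of all singletons and all subsets of $[n]$ with at least $k$ elements. For strictly positive parameters $y_I$ ($I\in\mathcal{B}_n^k$), let $P=\sum_{I\in\mathcal{B}_n^k} y_I\Delta_I\subset\mathbb{R}^n$ be the nestohedron of $\mathcal{B}_n^k$, a Minkowski sum of dilated simplices $\Delta_I=\mathrm{conv}\{e_i : i\in I\}$. The normal cone of a face $F$ of $P$ consists of the linear functionals $x=(x_1,\dots,x_n)$ whose maximum on $P$ is attained at all points of $F$. For each full-dimensional cone $\sigma$ of the normal fan $\mathcal{N}(P)$, let $Q_\sigma$ be the poset on $[n]$ in which $i\le_{Q_\sigma} j$ if and only if $x_i\le x_j$ for all $x\in\sigma$; let $\mathrm{Des}(Q_\sigma)$ be the set of pairs $(i,j)$ such that $j$ covers $i$ in $Q_\sigma$ and $i>j$ as integers, and put $\mathrm{des}(Q_\sigma)=|\mathrm{Des}(Q_\sigma)|$ and $\mathrm{maj}(Q_\sigma)=\sum_{(i,j)\in\mathrm{Des}(Q_\sigma)}\rho(j)$, where $\rho:Q_\sigma\to\mathbb{Z}_{\ge0}$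 is the minimal rank function of $Q_\sigma$. The $q$-$h$-polynomial of $P$ is \[ h_{\mathcal{B}_n^k}(t,q)=\sum_{\sigma} t^{\mathrm{des}(Q_\sigma)}q^{\mathrm{maj}(Q_\sigma)}, \] the sum being over all full-dimensional cones $\sigma$ of $\mathcal{N}(P)$. Then, for every choice of the parameters $y_I>0$, \[ h_{\mathcal{B}_n^k}(t,q)=\sum_{A\in\binom{[n]}{n-k+1}}\ \sum_{\pi\in S_A} t^{\mathrm{des}(\pi)+c(A,\pi)}\,q^{\mathrm{maj}(\pi)+\mathrm{des}(\pi)+c(A,\pi)},\qquad c(A,\pi)=|\{j\in[n]\setminus A : j>\pi_1\}|, \] where $S_A$ is the set of all arrangements $\pi=\pi_1\pi_2\cdots\pi_{n-k+1}$ of the elements of $A$, $\mathrm{des}(\pi)$ is the number of indices $i\in\{1,\dots,n-k\}$ with $\pi_i>\pi_{i+1}$, and $\mathrm{maj}(\pi)$ is the sum of these indices. Moreover, \[ h_{\mathcal{B}_n^k}(t,q)=t^{n-1}\,q^{\frac{k^2-2kn-k+n^2+3n-2}{2}}\,h_{\mathcal{B}_n^k}(t^{-1},q^{-1}). \] -/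

import Mathlib

open scoped Pointwise

noncomputable section

namespace QHPoly

/-! Vectors live in `Fin n → ℝ`; the ground set `[n]` is `Fin n` with its usual order.  Linear
functionals are identified with vectors through the dot product.  Cones in the quotient of
`ℝⁿ` by the line spanned by `(1, …, 1)` are represented by their preimages in `ℝⁿ`. -/

/-! ### Normal fans -/

/-- `F` is a nonempty face of `P`: the set of points of `P` where some linear functional attains
its maximum on `P`. -/
def IsFace {n : ℕ} (P F : Set (Fin n → ℝ)) : Prop :=
  F.Nonempty ∧ ∃ c : Fin n → ℝ, F = {x ∈ P | IsMaxOn (fun y => c ⬝ᵥ y) P x}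

/-- The normal cone of `F` in `P`: the functionals whose maximum on `P` occurs at all points
of `F`. -/
def normalCone {n : ℕ} (P F : Set (Fin n → ℝ)) : Set (Fin n → ℝ) :=
  {c | ∀ x ∈ F, IsMaxOn (fun y => c ⬝ᵥ y) P x}

/-- The normal fan of `P`: the normal cones of all the nonempty faces. -/
def normalFan {n : ℕ} (P : Set (Fin n → ℝ)) : Set (Set (Fin n → ℝ)) :=
  {σ | ∃ F, IsFace P F ∧ σ = normalCone P F}

/-- The full-dimensional cones of the normal fan. -/
def chambers {n : ℕ} (P : Set (Fin n → ℝ)) : Set (Set (Fin n → ℝ)) :=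
  {σ ∈ normalFan P | affineSpan ℝ σ = ⊤}

/-! ### Statistics of posets on `[n]` -/

/-- The order `Q_σ` on `[n]`: `i ≤ j` if `x i ≤ x j` for all `x ∈ σ`.  It is a partial order
whenever `σ` is full-dimensional, see `conePreorder_antisymm`. -/
abbrev conePreorder {n : ℕ} (σ : Set (Fin n → ℝ)) : Preorder (Fin n) where
  le i j := ∀ x ∈ σ, x i ≤ x j
  lt i j := (∀ x ∈ σ, x i ≤ x j) ∧ ¬ ∀ x ∈ σ, x j ≤ x i
  lt_iff_le_not_ge _ _ := Iff.rfl
  le_refl _ _ _ := le_rfl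
  le_trans _ _ _ h₁ h₂ x hx := (h₁ x hx).trans (h₂ x hx)

theorem conePreorder_antisymm {n : ℕ} {σ : Set (Fin n → ℝ)} (hσ : affineSpan ℝ σ = ⊤)
    {i j : Fin n} (hij : (conePreorder σ).le i j) (hji : (conePreorder σ).le j i) : i = j := by
  by_contra hne
  let W : Submodule ℝ (Fin n → ℝ) :=
    LinearMap.ker (LinearMap.proj (R := ℝ) (φ := fun _ : Fin n => ℝ) i - LinearMap.proj j)
  have h1 : affineSpan ℝ σ ≤ W.toAffineSubspace := by
    refine affineSpan_le.2 fun x hx => ?_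
    have h : x i = x j := le_antisymm (hij x hx) (hji x hx)
    simp [W, h]
  have h2 : (Pi.single i 1 : Fin n → ℝ) ∈ W.toAffineSubspace :=
    h1 (hσ ▸ AffineSubspace.mem_top ℝ _ _)
  have h3 : (1 : ℝ) - (Pi.single i 1 : Fin n → ℝ) j = 0 := by
    simpa [W] using h2
  rw [Pi.single_eq_of_ne (Ne.symm hne)] at h3
  norm_num at h3

/-- `i` is covered by `j` in `Q`. -/
def Covers {n : ℕ} (Q : Preorder (Fin n)) (i j : Fin n) : Prop :=
  Q.lt i j ∧ ¬ ∃ m, Q.lt i m ∧ Q.lt m j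

open Classical in
/-- The descent set of `Q`: the covering pairs `(i, j)` of `Q` (`i` below `j`) such that `i` is
the larger of the two numbers. -/
def posetDescents {n : ℕ} (Q : Preorder (Fin n)) : Finset (Fin n × Fin n) :=
  Finset.univ.filter fun p => Covers Q p.1 p.2 ∧ (p.2 : ℕ) < (p.1 : ℕ)

/-- The descent number of `Q`. -/
def posetDes {n : ℕ} (Q : Preorder (Fin n)) : ℕ := (posetDescents Q).card

/-- Rank functions of `Q`. -/
def IsRankFunction {n : ℕ} (Q : Preorder (Fin n)) (ρ : Fin n → ℕ) : Prop :=
  ∀ i j, Covers Q i j → ρ j = ρ i + 1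

/-- The minimal rank function of a graded `Q`, as the pointwise minimum of all its rank functions.
(On a connected `Q` any two rank functions differ by a constant, and this is the one that takes
the value `0`.) -/
def minRank {n : ℕ} (Q : Preorder (Fin n)) (i : Fin n) : ℕ :=
  sInf {r | ∃ ρ : Fin n → ℕ, IsRankFunction Q ρ ∧ ρ i = r}

/-- The major index of `Q`: the sum over the descents `(i, j)` of the rank of `j`. -/
def posetMaj {n : ℕ} (Q : Preorder (Fin n)) : ℕ :=
  ∑ p ∈ posetDescents Q, minRank Q p.2

/-- The `q`-`h`-polynomial of a simple generalized permutohedron `P`, in the variables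
`t = X 0` and `q = X 1`: the sum of `t ^ des(Q_σ) * q ^ maj(Q_σ)` over the full-dimensional cones
`σ` of the normal fan of `P`. -/
def qhPoly {n : ℕ} (P : Set (Fin n → ℝ)) : MvPolynomial (Fin 2) ℤ :=
  ∑ᶠ σ ∈ chambers P, MvPolynomial.X 0 ^ posetDes (conePreorder σ) *
    MvPolynomial.X 1 ^ posetMaj (conePreorder σ)

/-! ### Building sets and nestohedra -/

/-- A building set on `[n]`. -/
structure BuildingSet (n : ℕ) where
  /-- The members of the building set. -/
  sets : Finset (Finset (Fin n))
  nonempty_of_mem : ∀ I ∈ sets, I.Nonempty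
  union_mem : ∀ I ∈ sets, ∀ J ∈ sets, (I ∩ J).Nonempty → I ∪ J ∈ sets
  singleton_mem : ∀ i, {i} ∈ sets

/-- The simplex spanned by the standard basis vectors `e i`, `i ∈ I`. -/
def simplex {n : ℕ} (I : Finset (Fin n)) : Set (Fin n → ℝ) :=
  convexHull ℝ ((fun i : Fin n => (Pi.single i 1 : Fin n → ℝ)) '' (I : Set (Fin n)))

/-- The nestohedron of `B` with parameters `y`: the Minkowski sum of the dilated simplices
`y I • simplex I`, `I ∈ B`. -/
def nestohedron {n : ℕ} (B : BuildingSet n) (y : Finset (Fin n) → ℝ) : Set (Fin n → ℝ) :=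
  ∑ I ∈ B.sets, y I • simplex I

/-- The `S_n`-invariant building set on `[n]` that consists of the singletons and of all the
(nonempty) subsets with at least `k` elements. -/
def invariantBuildingSet (n k : ℕ) : BuildingSet n where
  sets := Finset.univ.filter fun I => I.Nonempty ∧ (I.card = 1 ∨ k ≤ I.card)
  nonempty_of_mem I hI := (Finset.mem_filter.1 hI).2.1
  union_mem I hI J hJ hIJ := by
    simp only [Finset.mem_filter, Finset.mem_univ, true_and] at hI hJ ⊢
    refine ⟨hI.1.mono Finset.subset_union_left, ?_⟩
    rcases hI.2 with h | h
    · rcases hJ.2 with h' | h'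
      · obtain ⟨a, rfl⟩ := Finset.card_eq_one.1 h
        obtain ⟨b, rfl⟩ := Finset.card_eq_one.1 h'
        obtain ⟨c, hc⟩ := hIJ
        simp only [Finset.mem_inter, Finset.mem_singleton] at hc
        obtain ⟨rfl, rfl⟩ := hc
        simp
      · exact Or.inr (h'.trans (Finset.card_le_card Finset.subset_union_right))
    · exact Or.inr (h.trans (Finset.card_le_card Finset.subset_union_left))
  singleton_mem i := by simp

/-! ### Statistics of words -/

/-- The descents of the word `w 0, w 1, …, w (m - 1)`, as zero-based positions: `i` stands for the
descent at the (one-based) position `i + 1`. -/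
def wordDescents {n m : ℕ} (w : Fin m → Fin n) : Finset (Fin m) :=
  Finset.univ.filter fun i => ∃ h : (i : ℕ) + 1 < m, w ⟨i + 1, h⟩ < w i

/-- The descent number of a word. -/
def wordDes {n m : ℕ} (w : Fin m → Fin n) : ℕ := (wordDescents w).card

/-- The major index of a word: the sum of the one-based positions of its descents. -/
def wordMaj {n m : ℕ} (w : Fin m → Fin n) : ℕ := ∑ i ∈ wordDescents w, ((i : ℕ) + 1)

/-- The number of elements of `[n] \ A` that are larger than `a`. -/
def numLarger {n : ℕ} (A : Finset (Fin n)) (a : Fin n) : ℕ :=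
  (Finset.univ.filter fun j => j ∉ A ∧ a < j).card

end QHPoly

end

namespace QHPoly

/-! A functional with distinct coordinates is maximal on the Minkowski sum at one point, found by
choosing in every `I` of the building set the index with the largest coordinate. Singletons offer no
choice, and the `k - 1` smallest coordinates are never largest in a set of size at least `k`. So the
vertex depends only on the ordered list of the other `n - k + 1` indices, a word `w` with distinct
letters. Conversely, the set of unlisted letters together with an initial segment of `w` has at
least `k` elements, so the vertex determines `w`. Hence the full-dimensional cones are exactly the
cones `wordCone w` (`normalCone_choicePoint`, `chambers_nestohedron`).

The poset of such a cone is an antichain of `k - 1` minimal letters below the chain `w`. Since `k ≥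
2` the antichain is nonempty, so the minimal rank is the position counted from `1`. A descent of `w`
at one-based position `p` contributes rank `p + 1`, and an unlisted letter above the first letter
contributes rank `1`; this gives `des + c` and `maj + des + c` (`sum_posetDescents_wordCone`).

For the symmetry, reversing the alphabet exchanges ascents and descents of `w` and turns `c` into `k
- 1 - c`. With `d = n - k`, the two exponents of `t` add up to `d + k - 1` and those of `q` to `d (d
+ 1) / 2 + d + k - 1`. -/

/-! ### The order attached to a word -/

/-- The position (counted from `1`) of a letter in the word `w`; letters that do not occur
get `0`. -/
def wordRank {n m : ℕ} (w : Fin m → Fin n) (a : Fin n) : ℕ :=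
  ∑ i, if w i = a then (i : ℕ) + 1 else 0

/-- The cone of all vectors that are weakly monotone with respect to `wordRank w`. -/
def wordCone {n m : ℕ} (w : Fin m → Fin n) : Set (Fin n → ℝ) :=
  {x | ∀ i j, wordRank w i < wordRank w j → x i ≤ x j}

section WordRank

variable {n m d : ℕ}

theorem wordRank_apply (w : Fin m ↪ Fin n) (i : Fin m) : wordRank w (w i) = i + 1 := by
  simp [wordRank, w.injective.eq_iff]

theorem wordRank_eq_zero {w : Fin m → Fin n} {a : Fin n} (ha : ∀ i, w i ≠ a) :
    wordRank w a = 0 := by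
  simp [wordRank, ha]

theorem exists_of_wordRank_pos {w : Fin m → Fin n} {a : Fin n} (ha : 0 < wordRank w a) :
    ∃ i, w i = a := by
  by_contra! h
  exact ha.ne' (wordRank_eq_zero h)

theorem wordRank_eq_succ_iff (w : Fin m ↪ Fin n) {a : Fin n} {i : Fin m} :
    wordRank w a = i + 1 ↔ a = w i := by
  constructor
  · intro h
    obtain ⟨j, rfl⟩ := exists_of_wordRank_pos (w := w) (a := a) (by omega)
    rw [wordRank_apply] at h
    rw [Fin.ext (Nat.succ_injective h)]
  · rintro rfl
    exact wordRank_apply w i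

theorem wordRank_eq_zero_iff (w : Fin m ↪ Fin n) {a : Fin n} :
    wordRank w a = 0 ↔ a ∉ Finset.univ.map w := by
  constructor
  · intro h ha
    obtain ⟨i, -, rfl⟩ := Finset.mem_map.1 ha
    rw [wordRank_apply] at h
    omega
  · intro h
    exact wordRank_eq_zero fun i hi => h (Finset.mem_map.2 ⟨i, Finset.mem_univ _, hi⟩)

theorem wordRank_le (w : Fin m ↪ Fin n) (a : Fin n) : wordRank w a ≤ m := by
  rcases Nat.eq_zero_or_pos (wordRank w a) with h | h
  · omega
  · obtain ⟨i, rfl⟩ := exists_of_wordRank_pos h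
    rw [wordRank_apply]
    omega

theorem eq_of_wordRank_eq (w : Fin m ↪ Fin n) {a b : Fin n} (h : wordRank w a = wordRank w b)
    (ha : 0 < wordRank w a) : a = b := by
  obtain ⟨i, rfl⟩ := exists_of_wordRank_pos ha
  rw [wordRank_apply] at h
  exact ((wordRank_eq_succ_iff w).1 h.symm).symm

theorem wordRank_injective {w w' : Fin m ↪ Fin n} (h : wordRank w = wordRank w') : w = w' := by
  ext i : 1
  rw [← wordRank_eq_succ_iff w', ← h, wordRank_apply]

theorem exists_wordRank_eq_zero (w : Fin m ↪ Fin n) (hm : m < n) : ∃ a, wordRank w a = 0 := by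
  by_contra! h
  have h1 : (Finset.univ : Finset (Fin n)) ⊆ Finset.univ.map w := fun a _ => by
    by_contra ha
    exact h a ((wordRank_eq_zero_iff w).2 ha)
  have h2 := Finset.card_le_card h1
  simp at h2
  omega

theorem exists_wordRank_eq (w : Fin m ↪ Fin n) (hm : m < n) {r : ℕ} (hr : r ≤ m) :
    ∃ a, wordRank w a = r := by
  rcases r with _ | r
  · exact exists_wordRank_eq_zero w hm
  · exact ⟨w ⟨r, hr⟩, wordRank_apply w _⟩

/-! ### The poset of a word cone -/

theorem wordCone_le_iff (w : Fin m ↪ Fin n) (i j : Fin n) :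
    (conePreorder (wordCone w)).le i j ↔ i = j ∨ wordRank w i < wordRank w j := by
  constructor
  · intro h
    by_contra! hne
    -- Doubled ranks leave room to raise `i` by one: the vector stays in the cone, yet `i` exceeds
    -- every other letter of rank at most its own.
    have h1 : (fun a => 2 * (wordRank w a : ℝ) + (Pi.single i 1 : Fin n → ℝ) a) ∈
        wordCone w := by
      intro a b hab
      have h2 : (wordRank w a : ℝ) + 1 ≤ wordRank w b := by exact_mod_cast hab
      have h3 : (Pi.single i 1 : Fin n → ℝ) a ≤ 1 := by
        rw [Pi.single_apply]; split_ifs <;> norm_num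
      have h4 : 0 ≤ (Pi.single i 1 : Fin n → ℝ) b := by
        rw [Pi.single_apply]; split_ifs <;> norm_num
      show 2 * (wordRank w a : ℝ) + _ ≤ 2 * (wordRank w b : ℝ) + _
      linarith
    have h2 := h _ h1
    have h3 : (wordRank w j : ℝ) ≤ wordRank w i := by exact_mod_cast hne.2
    simp only [Pi.single_eq_same, Pi.single_eq_of_ne hne.1.symm] at h2
    linarith
  · rintro (rfl | h)
    · exact fun _ _ => le_rfl
    · exact fun x hx => hx i j h

theorem wordCone_lt_iff (w : Fin m ↪ Fin n) (i j : Fin n) :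
    (conePreorder (wordCone w)).lt i j ↔ wordRank w i < wordRank w j := by
  have h1 := wordCone_le_iff w i j
  have h2 := wordCone_le_iff w j i
  rw [(conePreorder (wordCone w)).lt_iff_le_not_ge, h1, h2]
  constructor
  · rintro ⟨rfl | h, h'⟩
    · simp at h'
    · exact h
  · intro h
    refine ⟨Or.inr h, ?_⟩
    rintro (rfl | h')
    · exact lt_irrefl _ h
    · omega

/-- As `m < n`, some letter is unlisted, so every rank from `0` to `m` is attained and a jump of two
or more is never a cover. -/
theorem wordCone_covers_iff (w : Fin m ↪ Fin n) (hm : m < n) (i j : Fin n) :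
    Covers (conePreorder (wordCone w)) i j ↔ wordRank w j = wordRank w i + 1 := by
  simp only [Covers, wordCone_lt_iff]
  constructor
  · rintro ⟨h, h'⟩
    by_contra hne
    obtain ⟨a, ha⟩ := exists_wordRank_eq w hm
      (r := wordRank w i + 1) (by have := wordRank_le w j; omega)
    exact h' ⟨a, by omega, by omega⟩
  · intro h
    refine ⟨by omega, ?_⟩
    rintro ⟨a, h1, h2⟩
    omega

theorem wordRank_le_of_isRankFunction (w : Fin m ↪ Fin n) (hm : m < n) {ρ : Fin n → ℕ}
    (hρ : IsRankFunction (conePreorder (wordCone w)) ρ) (i : Fin n) : wordRank w i ≤ ρ i := by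
  generalize hr : wordRank w i = r
  induction r generalizing i with
  | zero => exact Nat.zero_le _
  | succ r ih =>
    obtain ⟨a, ha⟩ := exists_wordRank_eq w hm (r := r) (by have := wordRank_le w i; omega)
    rw [hρ a i ((wordCone_covers_iff w hm a i).2 (by omega))]
    exact Nat.succ_le_succ (ih a ha)

theorem minRank_wordCone (w : Fin m ↪ Fin n) (hm : m < n) :
    minRank (conePreorder (wordCone w)) = wordRank w := by
  funext i
  have h : wordRank w i ∈
      {r | ∃ ρ : Fin n → ℕ, IsRankFunction (conePreorder (wordCone w)) ρ ∧ ρ i = r} :=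
    ⟨wordRank w, fun a b hab => (wordCone_covers_iff w hm a b).1 hab, rfl⟩
  refine le_antisymm (Nat.sInf_le h) (le_csInf ⟨_, h⟩ ?_)
  rintro r ⟨ρ, hρ, rfl⟩
  exact wordRank_le_of_isRankFunction w hm hρ i

/-- The minimal rank function is computed from the cone alone and records the position of every
letter. -/
theorem wordCone_injective (hm : m < n) :
    Function.Injective fun w : Fin m ↪ Fin n => wordCone w := by
  intro w w' h
  apply wordRank_injective
  rw [← minRank_wordCone w hm, ← minRank_wordCone w' hm]
  exact congrArg (fun σ => minRank (conePreorder σ)) h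

/-! ### Descent statistics of a word poset. -/

/-- A cover starts either in the chain or at an unlisted letter. In the first case it joins
consecutive letters, and the upper one has rank `i + 2` for the zero-based position `i`; in the
second it ends at `w 0`, of rank `1`. A constant `f` yields the descent number, the identity yields
the major index. -/
theorem sum_posetDescents_wordCone (w : Fin (d + 1) ↪ Fin n) (hd : d + 1 < n) (f : ℕ → ℕ) :
    ∑ p ∈ posetDescents (conePreorder (wordCone w)), f (wordRank w p.2) =
      ∑ i ∈ wordDescents w, f (i + 2) + numLarger (Finset.univ.map w) (w 0) * f 1 := by
  classical
  rw [← Finset.sum_filter_add_sum_filter_not _ (fun p => wordRank w p.1 ≠ 0)]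
  congr 1
  · symm
    refine Finset.sum_bij (fun i hi => (w i, w ⟨i + 1, (Finset.mem_filter.1 hi).2.1⟩))
      ?_ ?_ ?_ ?_
    · intro i hi
      obtain ⟨h, hlt⟩ := (Finset.mem_filter.1 hi).2
      simp only [posetDescents, Finset.mem_filter, Finset.mem_univ, true_and,
        wordCone_covers_iff w hd, wordRank_apply]
      refine ⟨?_, by omega⟩
      simpa using hlt
    · intro i _ j _ hij
      exact w.injective (Prod.ext_iff.1 hij).1
    · rintro ⟨a, b⟩ hab
      simp only [posetDescents, Finset.mem_filter, Finset.mem_univ, true_and,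
        wordCone_covers_iff w hd] at hab
      obtain ⟨⟨hab, hlt⟩, ha⟩ := hab
      obtain ⟨i, rfl⟩ := exists_of_wordRank_pos (Nat.pos_of_ne_zero ha)
      obtain ⟨j, rfl⟩ := exists_of_wordRank_pos (w := w) (a := b) (by omega)
      simp only [wordRank_apply] at hab
      have hi : (i : ℕ) + 1 < d + 1 := by omega
      have hj : j = ⟨i + 1, hi⟩ := Fin.ext (by simp only; omega)
      rw [hj] at hlt
      exact ⟨i, Finset.mem_filter.2 ⟨Finset.mem_univ _, hi, hlt⟩, by rw [hj]⟩
    · intro i hi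
      simp only [wordRank_apply]
  · rw [numLarger, ← smul_eq_mul, ← Finset.sum_const]
    symm
    refine Finset.sum_bij (fun a _ => (a, w 0)) ?_ ?_ ?_ ?_
    · intro a ha
      simp only [posetDescents, Finset.mem_filter, Finset.mem_univ, true_and,
        wordCone_covers_iff w hd, wordRank_apply, ← wordRank_eq_zero_iff] at ha ⊢
      exact ⟨⟨by rw [ha.1]; rfl, ha.2⟩, by simpa using ha.1⟩
    · intro a _ b _ hab
      exact (Prod.ext_iff.1 hab).1
    · rintro ⟨a, b⟩ hab
      simp only [posetDescents, Finset.mem_filter, Finset.mem_univ, true_and,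
        wordCone_covers_iff w hd, not_not] at hab
      obtain ⟨⟨hab, hlt⟩, ha⟩ := hab
      have hb : b = w 0 := by
        rw [← wordRank_eq_succ_iff w, hab, ha]
        rfl
      subst hb
      exact ⟨a, Finset.mem_filter.2 ⟨Finset.mem_univ _, (wordRank_eq_zero_iff w).1 ha, hlt⟩, rfl⟩
    · intro a _
      simp only [wordRank_apply]
      rfl

theorem posetDes_wordCone (w : Fin (d + 1) ↪ Fin n) (hd : d + 1 < n) :
    posetDes (conePreorder (wordCone w)) =
      wordDes w + numLarger (Finset.univ.map w) (w 0) := by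
  have h := sum_posetDescents_wordCone w hd fun _ => 1
  simpa [posetDes, wordDes] using h

theorem posetMaj_wordCone (w : Fin (d + 1) ↪ Fin n) (hd : d + 1 < n) :
    posetMaj (conePreorder (wordCone w)) =
      wordMaj w + wordDes w + numLarger (Finset.univ.map w) (w 0) := by
  have h := sum_posetDescents_wordCone w hd id
  rw [posetMaj, minRank_wordCone w hd]
  simp only [id] at h
  rw [h, wordMaj, wordDes, Finset.card_eq_sum_ones, ← Finset.sum_add_distrib, mul_one]

/-! ### Reversal of the alphabet -/

theorem mem_wordDescents_rev_iff (w : Fin m ↪ Fin n) (i : Fin m) :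
    i ∈ wordDescents (w.trans Fin.revPerm.toEmbedding) ↔ (i : ℕ) + 1 < m ∧ i ∉ wordDescents w := by
  simp only [wordDescents, Finset.mem_filter, Finset.mem_univ, true_and]
  constructor
  · rintro ⟨h, hlt⟩
    refine ⟨h, ?_⟩
    rintro ⟨_, hlt'⟩
    simp at hlt
    exact lt_asymm hlt hlt'
  · rintro ⟨h, hn⟩
    refine ⟨h, ?_⟩
    simp only [Function.Embedding.trans_apply, Equiv.coe_toEmbedding, Fin.revPerm_apply,
      Fin.rev_lt_rev]
    refine lt_of_le_of_ne (not_lt.1 fun hlt => hn ⟨h, hlt⟩) fun heq => ?_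
    have := congrArg Fin.val (w.injective heq)
    simp at this

/-- Letters are distinct, so each of the `d` adjacent pairs is a descent of exactly one of the two
words. -/
theorem sum_wordDescents_add_rev (w : Fin (d + 1) ↪ Fin n) (f : ℕ → ℕ) :
    ∑ i ∈ wordDescents w, f i +
      ∑ i ∈ wordDescents (w.trans Fin.revPerm.toEmbedding), f i = ∑ i ∈ Finset.range d, f i := by
  classical
  have h1 : ∑ i ∈ Finset.range d, f i =
      ∑ i ∈ Finset.univ.filter (fun i : Fin (d + 1) => (i : ℕ) + 1 < d + 1), f i := by
    rw [Finset.sum_filter, Fin.sum_univ_castSucc]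
    simp [Finset.sum_range]
  rw [h1, ← Finset.sum_filter_add_sum_filter_not
    (Finset.univ.filter fun i : Fin (d + 1) => (i : ℕ) + 1 < d + 1) (fun i => i ∈ wordDescents w)]
  congr 1
  · refine Finset.sum_congr ?_ fun _ _ => rfl
    ext i
    simp only [Finset.mem_filter, Finset.mem_univ, true_and]
    exact ⟨fun h => ⟨(Finset.mem_filter.1 h).2.1, h⟩, fun h => h.2⟩
  · refine Finset.sum_congr ?_ fun _ _ => rfl
    ext i
    rw [mem_wordDescents_rev_iff]
    simp

/-- No unlisted letter equals `w 0`; reversal turns the smaller ones into larger ones. -/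
theorem numLarger_add_rev (w : Fin (d + 1) ↪ Fin n) :
    numLarger (Finset.univ.map w) (w 0) +
      numLarger (Finset.univ.map (w.trans Fin.revPerm.toEmbedding))
        (w.trans Fin.revPerm.toEmbedding 0) = n - (d + 1) := by
  classical
  have h1 : (Finset.univ.map w)ᶜ.card = n - (d + 1) := by
    simp [Finset.card_compl]
  rw [← h1, ← Finset.card_filter_add_card_filter_not (fun a => w 0 < a), numLarger, numLarger]
  congr 1
  · congr 1
    ext a
    simp
  · refine Finset.card_bij (fun a _ => Fin.rev a) ?_ ?_ ?_
    · intro a ha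
      simp only [Finset.mem_filter, Finset.mem_univ, true_and, Finset.mem_map,
        Function.Embedding.trans_apply, Equiv.coe_toEmbedding, Fin.revPerm_apply,
        Finset.mem_compl, not_lt] at ha ⊢
      refine ⟨fun ⟨i, hi⟩ => ha.1 ⟨i, by rw [hi, Fin.rev_rev]⟩, ?_⟩
      rw [← Fin.rev_le_rev, Fin.rev_rev]
      exact ha.2.le
    · intro a _ b _ h
      exact Fin.rev_injective h
    · intro a ha
      simp only [Finset.mem_filter, Finset.mem_univ, true_and, Finset.mem_map,
        Function.Embedding.trans_apply, Equiv.coe_toEmbedding, Fin.revPerm_apply,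
        Finset.mem_compl, not_lt] at ha ⊢
      refine ⟨Fin.rev a, ⟨fun ⟨i, hi⟩ => ha.1 ⟨i, Fin.rev_injective hi⟩, ?_⟩, Fin.rev_rev a⟩
      rw [Fin.rev_lt_rev]
      exact lt_of_le_of_ne ha.2 fun h => ha.1 ⟨0, h.symm⟩

end WordRank

/-! ### Points and faces of nestohedra -/

section Nestohedron

variable {n : ℕ}

theorem single_mem_simplex {I : Finset (Fin n)} {i : Fin n} (hi : i ∈ I) :
    (Pi.single i 1 : Fin n → ℝ) ∈ simplex I :=
  subset_convexHull ℝ _ ⟨i, hi, rfl⟩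

theorem mem_simplex_imp {I : Finset (Fin n)} {u : Fin n → ℝ} (hu : u ∈ simplex I) :
    (∀ i, 0 ≤ u i) ∧ ∑ i, u i = 1 ∧ ∀ i ∉ I, u i = 0 := by
  have h : simplex I ⊆ {u | (∀ i, 0 ≤ u i) ∧ ∑ i, u i = 1 ∧ ∀ i ∉ I, u i = 0} := by
    refine convexHull_min ?_ ?_
    · rintro _ ⟨i, hi, rfl⟩
      refine ⟨fun j => ?_, by simp, fun j hj => ?_⟩
      · simp only [Pi.single_apply]; split_ifs <;> norm_num
      · exact Pi.single_eq_of_ne (fun h : j = i => hj (by rw [h]; exact hi)) _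
    · rintro u ⟨hu0, hu1, huI⟩ v ⟨hv0, hv1, hvI⟩ a b ha hb hab
      refine ⟨fun i => ?_, ?_, fun i hi => ?_⟩
      · exact add_nonneg (mul_nonneg ha (hu0 i)) (mul_nonneg hb (hv0 i))
      · simp [Finset.sum_add_distrib, ← Finset.mul_sum, hu1, hv1, hab]
      · simp [huI i hi, hvI i hi]
  exact h hu

theorem mem_nestohedron_iff {B : BuildingSet n} {y : Finset (Fin n) → ℝ} {x : Fin n → ℝ} :
    x ∈ nestohedron B y ↔
      ∃ u : Finset (Fin n) → Fin n → ℝ, (∀ I ∈ B.sets, u I ∈ simplex I) ∧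
        ∑ I ∈ B.sets, y I • u I = x := by
  rw [nestohedron, Set.mem_finsetSum]
  constructor
  · rintro ⟨g, hg, rfl⟩
    choose! u hu using fun I (hI : I ∈ B.sets) => Set.mem_smul_set.1 (hg hI)
    exact ⟨u, fun I hI => (hu I hI).1, Finset.sum_congr rfl fun I hI => (hu I hI).2⟩
  · rintro ⟨u, hu, rfl⟩
    exact ⟨fun I => y I • u I, fun hI => Set.smul_mem_smul_set (hu _ hI), rfl⟩

theorem dotProduct_nestohedron_sum (B : BuildingSet n) (y : Finset (Fin n) → ℝ) (c : Fin n → ℝ)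
    (u : Finset (Fin n) → Fin n → ℝ) :
    c ⬝ᵥ ∑ I ∈ B.sets, y I • u I = ∑ I ∈ B.sets, y I * (c ⬝ᵥ u I) := by
  rw [dotProduct_sum]
  simp

theorem dotProduct_le_of_mem_simplex {I : Finset (Fin n)} {u c : Fin n → ℝ}
    (hu : u ∈ simplex I) {M : ℝ} (hM : ∀ i ∈ I, c i ≤ M) : c ⬝ᵥ u ≤ M := by
  obtain ⟨h0, h1, hI⟩ := mem_simplex_imp hu
  calc c ⬝ᵥ u ≤ ∑ i, M * u i := by
        refine Finset.sum_le_sum fun i _ => ?_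
        by_cases hi : i ∈ I
        · exact mul_le_mul_of_nonneg_right (hM i hi) (h0 i)
        · simp [hI i hi]
    _ = M := by rw [← Finset.mul_sum, h1, mul_one]

/-- The terms `(c a - c i) * u i` are nonnegative with sum `c a - c ⬝ᵥ u ≤ 0`, so all vanish, which
kills every coordinate of `u` but the one at `a`. -/
theorem eq_single_of_dotProduct_eq {I : Finset (Fin n)} {u c : Fin n → ℝ}
    (hu : u ∈ simplex I) {a : Fin n} (ha : ∀ i ∈ I, i ≠ a → c i < c a)
    (h : c a ≤ c ⬝ᵥ u) : u = Pi.single a 1 := by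
  obtain ⟨h0, h1, hI⟩ := mem_simplex_imp hu
  have hnn : ∀ i ∈ Finset.univ, 0 ≤ (c a - c i) * u i := by
    intro i _
    by_cases hi : i ∈ I
    · by_cases hia : i = a
      · simp [hia]
      · exact mul_nonneg (sub_nonneg.2 (ha i hi hia).le) (h0 i)
    · simp [hI i hi]
  have hsum : ∑ i, (c a - c i) * u i = c a - c ⬝ᵥ u := by
    simp only [sub_mul, Finset.sum_sub_distrib, ← Finset.mul_sum, h1, mul_one, dotProduct]
  have hz : ∑ i, (c a - c i) * u i = 0 :=
    le_antisymm (by rw [hsum]; linarith) (Finset.sum_nonneg hnn)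
  have hzi := (Finset.sum_eq_zero_iff_of_nonneg hnn).1 hz
  have hne : ∀ i, i ≠ a → u i = 0 := by
    intro i hia
    by_cases hi : i ∈ I
    · exact (mul_eq_zero.1 (hzi i (Finset.mem_univ i))).resolve_left
        (sub_pos.2 (ha i hi hia)).ne'
    · exact hI i hi
  ext i
  by_cases hia : i = a
  · subst hia
    rw [Pi.single_eq_same, ← h1, Finset.sum_eq_single i (fun j _ hj => hne j hj) (by simp)]
  · rw [hne i hia, Pi.single_eq_of_ne hia]

/-- The point of the nestohedron that is obtained from a choice of a vertex in every simplex. -/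
def choicePoint (B : BuildingSet n) (y : Finset (Fin n) → ℝ) (φ : Finset (Fin n) → Fin n) :
    Fin n → ℝ :=
  ∑ I ∈ B.sets, y I • (Pi.single (φ I) 1 : Fin n → ℝ)

theorem choicePoint_mem {B : BuildingSet n} {y : Finset (Fin n) → ℝ} {φ : Finset (Fin n) → Fin n}
    (hφ : ∀ I ∈ B.sets, φ I ∈ I) : choicePoint B y φ ∈ nestohedron B y :=
  mem_nestohedron_iff.2 ⟨_, fun I hI => single_mem_simplex (hφ I hI), rfl⟩

theorem dotProduct_choicePoint (B : BuildingSet n) (y : Finset (Fin n) → ℝ)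
    (φ : Finset (Fin n) → Fin n) (c : Fin n → ℝ) :
    c ⬝ᵥ choicePoint B y φ = ∑ I ∈ B.sets, y I * c (φ I) := by
  rw [choicePoint, dotProduct_nestohedron_sum]
  simp

/-- A functional is maximal on a Minkowski sum exactly when it is maximal on every summand. -/
theorem isMaxOn_choicePoint_iff {B : BuildingSet n} {y : Finset (Fin n) → ℝ}
    (hy : ∀ I ∈ B.sets, 0 < y I) {φ : Finset (Fin n) → Fin n} (hφ : ∀ I ∈ B.sets, φ I ∈ I)
    (c : Fin n → ℝ) :
    IsMaxOn (fun z => c ⬝ᵥ z) (nestohedron B y) (choicePoint B y φ) ↔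
      ∀ I ∈ B.sets, ∀ i ∈ I, c i ≤ c (φ I) := by
  classical
  constructor
  · intro h I hI i hi
    -- Changing the choice at `I` alone moves the value by `y I * (c i - c (φ I))`, and `y I` is
    -- positive.
    have hψ : ∀ J ∈ B.sets, Function.update φ I i J ∈ J := by
      intro J hJ
      by_cases hJI : J = I
      · subst hJI; simpa using hi
      · rw [Function.update_of_ne hJI]; exact hφ J hJ
    have h1 : c ⬝ᵥ choicePoint B y (Function.update φ I i) ≤ c ⬝ᵥ choicePoint B y φ :=
      h (choicePoint_mem hψ)
    rw [dotProduct_choicePoint, dotProduct_choicePoint, ← Finset.add_sum_erase _ _ hI,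
      ← Finset.add_sum_erase _ (fun J => y J * c (φ J)) hI, Function.update_self,
      Finset.sum_congr rfl (g := fun J => y J * c (φ J)) fun J hJ => by
        rw [Function.update_of_ne (Finset.ne_of_mem_erase hJ)]] at h1
    exact le_of_mul_le_mul_left (le_of_add_le_add_right h1) (hy I hI)
  · intro h x hx
    obtain ⟨u, hu, rfl⟩ := mem_nestohedron_iff.1 hx
    show c ⬝ᵥ _ ≤ c ⬝ᵥ _
    rw [dotProduct_choicePoint, dotProduct_nestohedron_sum]
    exact Finset.sum_le_sum fun I hI =>
      mul_le_mul_of_nonneg_left (dotProduct_le_of_mem_simplex (hu I hI) (h I hI)) (hy I hI).le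

theorem eq_choicePoint_of_isMaxOn {B : BuildingSet n} {y : Finset (Fin n) → ℝ}
    (hy : ∀ I ∈ B.sets, 0 < y I) {φ : Finset (Fin n) → Fin n} (hφ : ∀ I ∈ B.sets, φ I ∈ I)
    {c : Fin n → ℝ} (hc : ∀ I ∈ B.sets, ∀ i ∈ I, i ≠ φ I → c i < c (φ I)) {x : Fin n → ℝ}
    (hx : x ∈ nestohedron B y) (hmax : IsMaxOn (fun z => c ⬝ᵥ z) (nestohedron B y) x) :
    x = choicePoint B y φ := by
  obtain ⟨u, hu, rfl⟩ := mem_nestohedron_iff.1 hx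
  have hc' : ∀ I ∈ B.sets, ∀ i ∈ I, c i ≤ c (φ I) := by
    intro I hI i hi
    by_cases h : i = φ I
    · rw [← h]
    · exact (hc I hI i hi h).le
  have hle : ∀ I ∈ B.sets, y I * (c ⬝ᵥ u I) ≤ y I * c (φ I) := fun I hI =>
    mul_le_mul_of_nonneg_left (dotProduct_le_of_mem_simplex (hu I hI) (hc' I hI)) (hy I hI).le
  have h1 : c ⬝ᵥ choicePoint B y φ ≤ c ⬝ᵥ ∑ I ∈ B.sets, y I • u I := hmax (choicePoint_mem hφ)
  rw [dotProduct_choicePoint, dotProduct_nestohedron_sum] at h1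
  have h2 := (Finset.sum_eq_sum_iff_of_le hle).1 (le_antisymm (Finset.sum_le_sum hle) h1)
  refine Finset.sum_congr rfl fun I hI => ?_
  rw [eq_single_of_dotProduct_eq (hu I hI) (hc I hI)
    (le_of_mul_le_mul_left (h2 I hI).ge (hy I hI))]

/-! ### Chambers -/

theorem normalCone_add_smul_mem {P F : Set (Fin n → ℝ)} {x z : Fin n → ℝ}
    (hx : x ∈ normalCone P F) (hz : z ∈ normalCone P F) {ε : ℝ} (hε : 0 ≤ ε) :
    x + ε • z ∈ normalCone P F := by
  intro p hp v hv
  have h1 : x ⬝ᵥ v ≤ x ⬝ᵥ p := hx p hp hv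
  have h2 : z ⬝ᵥ v ≤ z ⬝ᵥ p := hz p hp hv
  show (x + ε • z) ⬝ᵥ v ≤ (x + ε • z) ⬝ᵥ p
  rw [add_dotProduct, add_dotProduct, smul_dotProduct, smul_dotProduct, smul_eq_mul, smul_eq_mul]
  gcongr

/-- Coordinate pairs are separated one at a time: if `x` separates the earlier pairs and `z` the new
one, `x + ε • z` separates all of them for small `ε > 0`. A suitable `z` exists because a
full-dimensional cone lies in no hyperplane `z i = z j`. -/
theorem exists_injective_mem_normalCone {P F : Set (Fin n → ℝ)}
    (h : affineSpan ℝ (normalCone P F) = ⊤) : ∃ c ∈ normalCone P F, Function.Injective c := by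
  classical
  suffices H : ∀ S : Finset (Fin n × Fin n), ∃ c ∈ normalCone P F,
      ∀ p ∈ S, p.1 ≠ p.2 → c p.1 ≠ c p.2 by
    obtain ⟨c, hc, hinj⟩ := H Finset.univ
    refine ⟨c, hc, fun i j hij => ?_⟩
    by_contra hne
    exact hinj (i, j) (Finset.mem_univ _) hne hij
  intro S
  induction S using Finset.induction_on with
  | empty => exact ⟨0, fun _ _ _ _ => by simp, by simp⟩
  | insert p S _ ih =>
    obtain ⟨x, hx, hxS⟩ := ih
    by_cases hp : p.1 ≠ p.2 → x p.1 ≠ x p.2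
    · exact ⟨x, hx, fun q hq => by
        rcases Finset.mem_insert.1 hq with rfl | hq
        exacts [hp, hxS q hq]⟩
    push Not at hp
    obtain ⟨hne, hxp⟩ := hp
    obtain ⟨z, hz, hzp⟩ : ∃ z ∈ normalCone P F, z p.1 ≠ z p.2 := by
      by_contra! hall
      exact hne (conePreorder_antisymm h (fun z hz => (hall z hz).le) fun z hz => (hall z hz).ge)
    have hev : ∀ᶠ ε : ℝ in nhdsWithin 0 (Set.Ioi 0), ∀ q ∈ S, q.1 ≠ q.2 →
        (x + ε • z) q.1 ≠ (x + ε • z) q.2 := by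
      refine nhdsWithin_le_nhds ((Filter.eventually_all_finset S).2 fun q hq => ?_)
      by_cases hq' : q.1 = q.2
      · simp [hq']
      have hcont : Continuous fun ε : ℝ => (x + ε • z) q.1 - (x + ε • z) q.2 := by
        simp only [Pi.add_apply, Pi.smul_apply, smul_eq_mul]
        fun_prop
      have h0 : (fun ε : ℝ => (x + ε • z) q.1 - (x + ε • z) q.2) 0 ≠ 0 := by
        simpa [sub_ne_zero] using hxS q hq hq'
      filter_upwards [hcont.continuousAt.eventually_ne h0] with ε hε _
      exact sub_ne_zero.1 hε
    obtain ⟨ε, hεS, hε⟩ := (hev.and self_mem_nhdsWithin).exists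
    have hε : 0 < ε := hε
    refine ⟨x + ε • z, normalCone_add_smul_mem hx hz hε.le, fun q hq => ?_⟩
    rcases Finset.mem_insert.1 hq with rfl | hq
    · intro _
      simpa [hxp, hε.ne'] using hzp
    · exact hεS q hq

/-! ### Words of generic functionals and their vertices. -/

theorem exists_word_of_injective {m : ℕ} (hm : m ≤ n) {c : Fin n → ℝ}
    (hc : Function.Injective c) :
    ∃ w : Fin m ↪ Fin n, ∀ i j, wordRank w i < wordRank w j → c i < c j := by
  have hs : StrictMono (c ∘ Tuple.sort c) :=
    (Tuple.monotone_sort c).strictMono_of_injective (hc.comp (Tuple.sort c).injective)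
  obtain ⟨g, hg⟩ : ∃ g : Fin m ↪ Fin n, ∀ i, (g i : ℕ) = i + (n - m) :=
    ⟨⟨fun i => ⟨i + (n - m), by omega⟩, fun i j hij => by
      have := congrArg Fin.val hij
      simp only at this
      exact Fin.ext (by omega)⟩, fun _ => rfl⟩
  -- The word lists the last `m` indices in increasing order of `c`; truncated subtraction gives
  -- rank `0` to the other `n - m`.
  have hrank : ∀ a : Fin n,
      wordRank (g.trans (Tuple.sort c).toEmbedding) (Tuple.sort c a) = a + 1 - (n - m) := by
    intro a
    by_cases ha : n - m ≤ a
    · have h1 : Tuple.sort c a = g.trans (Tuple.sort c).toEmbedding ⟨a - (n - m), by omega⟩ := by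
        simp only [Function.Embedding.trans_apply, Equiv.coe_toEmbedding]
        congr 1
        exact Fin.ext (by rw [hg]; simp only; omega)
      rw [h1, wordRank_apply]
      simp only
      omega
    · rw [wordRank_eq_zero]
      · omega
      · intro i hi
        have h1 : g i = a := (Tuple.sort c).injective hi
        have h2 := hg i
        rw [h1] at h2
        omega
  refine ⟨g.trans (Tuple.sort c).toEmbedding, fun i j hij => ?_⟩
  obtain ⟨a, rfl⟩ := (Tuple.sort c).surjective i
  obtain ⟨b, rfl⟩ := (Tuple.sort c).surjective j
  rw [hrank, hrank] at hij
  exact hs (Fin.lt_def.2 (by omega))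

/-- The cone contains the nonempty open set of strictly monotone vectors. -/
theorem affineSpan_wordCone {m : ℕ} (w : Fin m → Fin n) : affineSpan ℝ (wordCone w) = ⊤ := by
  have hopen : IsOpen {x : Fin n → ℝ | ∀ i j, wordRank w i < wordRank w j → x i < x j} := by
    simp only [Set.ofPred_forall]
    refine isOpen_iInter_of_finite fun i => isOpen_iInter_of_finite fun j =>
      isOpen_iInter_of_finite fun _ => ?_
    exact isOpen_lt (continuous_apply i) (continuous_apply j)
  have hne : {x : Fin n → ℝ | ∀ i j, wordRank w i < wordRank w j → x i < x j}.Nonempty :=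
    ⟨fun i => wordRank w i, fun i j hij => Nat.cast_lt.2 hij⟩
  refine top_unique ((hopen.affineSpan_eq_top hne).ge.trans (affineSpan_mono ℝ ?_))
  exact fun x hx i j hij => (hx i j hij).le

/-- Ties occur only at rank `0`. Only `n - m = k - 1` letters have that rank, so a non-singleton
member of the building set reaches a positive rank. -/
theorem exists_unique_top {k m : ℕ} (hn : 0 < n) (hmk : m + k = n + 1) (w : Fin m ↪ Fin n) :
    ∃ φ : Finset (Fin n) → Fin n, ∀ I ∈ (invariantBuildingSet n k).sets,
      φ I ∈ I ∧ ∀ i ∈ I, i ≠ φ I → wordRank w i < wordRank w (φ I) := by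
  have h : ∀ I ∈ (invariantBuildingSet n k).sets,
      ∃ a, a ∈ I ∧ ∀ i ∈ I, i ≠ a → wordRank w i < wordRank w a := by
    intro I hI
    obtain ⟨hne, hcard⟩ := (Finset.mem_filter.1 hI).2
    obtain ⟨a, ha, hmax⟩ := Finset.exists_max_image I (wordRank w) hne
    refine ⟨a, ha, fun i hi hia => lt_of_le_of_ne (hmax i hi) fun heq => ?_⟩
    rcases Nat.eq_zero_or_pos (wordRank w i) with h0 | h0
    · have hsub : I ⊆ (Finset.univ.map w)ᶜ := fun j hj => by
        rw [Finset.mem_compl, ← wordRank_eq_zero_iff]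
        have := hmax j hj
        omega
      have hle := Finset.card_le_card hsub
      rw [Finset.card_compl, Finset.card_map, Finset.card_univ, Fintype.card_fin,
        Fintype.card_fin] at hle
      have h1 : 1 < I.card := Finset.one_lt_card.2 ⟨i, hi, a, ha, hia⟩
      omega
    · exact hia (eq_of_wordRank_eq w heq h0)
  have : Nonempty (Fin n) := ⟨⟨0, hn⟩⟩
  choose! φ hφ using h
  exact ⟨φ, hφ⟩

theorem normalCone_choicePoint {k m : ℕ} (hmk : m + k = n + 1) (w : Fin m ↪ Fin n)
    {y : Finset (Fin n) → ℝ} (hy : ∀ I ∈ (invariantBuildingSet n k).sets, 0 < y I)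
    {φ : Finset (Fin n) → Fin n} (hφ : ∀ I ∈ (invariantBuildingSet n k).sets,
      φ I ∈ I ∧ ∀ i ∈ I, i ≠ φ I → wordRank w i < wordRank w (φ I)) :
    normalCone (nestohedron (invariantBuildingSet n k) y)
      {choicePoint (invariantBuildingSet n k) y φ} = wordCone w := by
  classical
  ext c
  simp only [normalCone, Set.mem_singleton_iff, forall_eq, Set.mem_ofPred_eq,
    isMaxOn_choicePoint_iff hy (fun I hI => (hφ I hI).1)]
  constructor
  · intro h i j hij
    obtain ⟨s, rfl⟩ := exists_of_wordRank_pos (Nat.zero_lt_of_lt hij)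
    rw [wordRank_apply] at hij
    -- The `k - 1` unlisted letters and the first `s + 1` letters of `w`: large enough to lie in the
    -- building set, with top letter `w s`, hence testing every inequality below `w s` at once.
    let I : Finset (Fin n) :=
      (Finset.univ.map w)ᶜ ∪ (Finset.Iic s).map w
    have hcard : k ≤ I.card := by
      rw [Finset.card_union_of_disjoint, Finset.card_compl, Finset.card_map, Finset.card_map,
        Finset.card_univ, Fintype.card_fin, Fintype.card_fin, Fin.card_Iic]
      · omega
      · refine Finset.disjoint_left.2 fun a ha hb => Finset.mem_compl.1 ha ?_
        exact Finset.map_subset_map.2 (Finset.subset_univ _) hb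
    have hmem : ∀ a, a ∈ I ↔ wordRank w a ≤ s + 1 := by
      intro a
      rw [Finset.mem_union, Finset.mem_compl, ← wordRank_eq_zero_iff, Finset.mem_map]
      simp only [Finset.mem_Iic]
      constructor
      · rintro (h0 | ⟨r, hr, rfl⟩)
        · omega
        · rw [wordRank_apply]
          exact Nat.succ_le_succ hr
      · intro hle
        rcases Nat.eq_zero_or_pos (wordRank w a) with h0 | h0
        · exact Or.inl h0
        · obtain ⟨r, rfl⟩ := exists_of_wordRank_pos h0
          rw [wordRank_apply] at hle
          exact Or.inr ⟨r, Nat.le_of_succ_le_succ hle, rfl⟩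
    have hs : w s ∈ I := (hmem _).2 (wordRank_apply w s).le
    have hI : I ∈ (invariantBuildingSet n k).sets :=
      Finset.mem_filter.2 ⟨Finset.mem_univ _, ⟨_, hs⟩, Or.inr hcard⟩
    have htop : φ I = w s := by
      by_contra hne
      have h1 := (hφ I hI).2 _ hs (Ne.symm hne)
      have h2 := (hmem _).1 (hφ I hI).1
      rw [wordRank_apply] at h1
      omega
    rw [← htop]
    exact h I hI i ((hmem i).2 hij.le)
  · intro h I hI i hi
    by_cases hi' : i = φ I
    · rw [← hi']
    · exact h _ _ ((hφ I hI).2 i hi hi')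

theorem chambers_nestohedron {k m : ℕ} (hmk : m + k = n + 1)
    (hk : 2 ≤ k) {y : Finset (Fin n) → ℝ}
    (hy : ∀ I ∈ (invariantBuildingSet n k).sets, 0 < y I) :
    chambers (nestohedron (invariantBuildingSet n k) y) =
      Set.range fun w : Fin m ↪ Fin n => wordCone w := by
  ext σ
  constructor
  · rintro ⟨⟨F, ⟨hne, c, rfl⟩, rfl⟩, hspan⟩
    obtain ⟨c', hc', hinj⟩ := exists_injective_mem_normalCone hspan
    obtain ⟨w, hw⟩ := exists_word_of_injective (m := m) (by omega) hinj
    obtain ⟨φ, hφ⟩ := exists_unique_top (by omega) hmk w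
    refine ⟨w, ?_⟩
    dsimp only
    rw [← normalCone_choicePoint hmk w hy hφ]
    congr 1
    -- The generic functional `c'` is maximal on all of `F` but has a unique maximum point, so `F`
    -- is a vertex.
    refine (hne.subset_singleton_iff.1 fun x hx => ?_).symm
    exact eq_choicePoint_of_isMaxOn hy (fun I hI => (hφ I hI).1)
      (fun I hI i hi hne => hw _ _ ((hφ I hI).2 i hi hne)) hx.1 (hc' x hx)
  · rintro ⟨w, rfl⟩
    obtain ⟨φ, hφ⟩ := exists_unique_top (by omega) hmk w
    -- The rank function, read as a functional, exposes the vertex.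
    refine ⟨⟨_, ⟨Set.singleton_nonempty _, fun i => wordRank w i, ?_⟩,
      (normalCone_choicePoint hmk w hy hφ).symm⟩, affineSpan_wordCone w⟩
    have hlt : ∀ I ∈ (invariantBuildingSet n k).sets, ∀ i ∈ I, i ≠ φ I →
        (wordRank w i : ℝ) < wordRank w (φ I) := fun I hI i hi hne => by
      exact_mod_cast (hφ I hI).2 i hi hne
    ext x
    constructor
    · rintro rfl
      refine ⟨choicePoint_mem fun I hI => (hφ I hI).1,
        (isMaxOn_choicePoint_iff hy (fun I hI => (hφ I hI).1) _).2 fun I hI i hi => ?_⟩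
      by_cases hi' : i = φ I
      · rw [← hi']
      · exact (hlt I hI i hi hi').le
    · rintro ⟨hx, hmax⟩
      exact eq_choicePoint_of_isMaxOn hy (fun I hI => (hφ I hI).1) hlt hx hmax

theorem qhPoly_nestohedron {k d : ℕ} (hk : 2 ≤ k) (hdk : d + k = n)
    {y : Finset (Fin n) → ℝ} (hy : ∀ I ∈ (invariantBuildingSet n k).sets, 0 < y I) :
    qhPoly (nestohedron (invariantBuildingSet n k) y) =
      ∑ w : Fin (d + 1) ↪ Fin n,
        MvPolynomial.X 0 ^ (wordDes w + numLarger (Finset.univ.map w) (w 0)) *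
          MvPolynomial.X 1 ^
            (wordMaj w + wordDes w + numLarger (Finset.univ.map w) (w 0)) := by
  have hd : d + 1 < n := by omega
  rw [qhPoly, chambers_nestohedron (m := d + 1) (by omega) hk hy,
    finsum_mem_range (wordCone_injective hd), finsum_eq_sum_of_fintype]
  exact Finset.sum_congr rfl fun w _ => by rw [posetDes_wordCone w hd, posetMaj_wordCone w hd]

end Nestohedron

/-! ### Summation over words -/

/-- An injective word amounts to its set of letters together with a bijection onto that set. -/
theorem sum_powersetCard_sum_equiv {M : Type*} [AddCommMonoid M] {n m : ℕ}
    (G : Finset (Fin n) → (Fin m → Fin n) → M) :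
    ∑ A ∈ Finset.powersetCard m (Finset.univ : Finset (Fin n)),
      ∑ π : Fin m ≃ {a : Fin n // a ∈ A}, G A (fun i => (π i : Fin n)) =
    ∑ w : Fin m ↪ Fin n, G (Finset.univ.map w) w := by
  classical
  rw [← Finset.sum_fiberwise_of_maps_to (s := (Finset.univ : Finset (Fin m ↪ Fin n)))
    (t := Finset.powersetCard m (Finset.univ : Finset (Fin n)))
    (g := fun w => Finset.univ.map w) (fun w _ => by simp [Finset.mem_powersetCard])]
  refine Finset.sum_congr rfl fun A _ => ?_
  refine Finset.sum_bij
    (fun π _ => π.toEmbedding.trans (Function.Embedding.subtype fun a => a ∈ A)) ?_ ?_ ?_ ?_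
  · intro π _
    refine Finset.mem_filter.2 ⟨Finset.mem_univ _, ?_⟩
    ext a
    simp only [Finset.mem_map, Finset.mem_univ, true_and, Function.Embedding.trans_apply,
      Equiv.coe_toEmbedding, Function.Embedding.subtype_apply]
    constructor
    · rintro ⟨i, rfl⟩
      exact (π i).2
    · intro ha
      exact ⟨π.symm ⟨a, ha⟩, by simp⟩
  · intro π _ π' _ h
    ext i : 2
    exact DFunLike.congr_fun h i
  · intro w hw
    obtain rfl := (Finset.mem_filter.1 hw).2
    refine ⟨Equiv.ofBijective
      (fun i => ⟨w i, Finset.mem_map_of_mem w (Finset.mem_univ i)⟩) ⟨?_, ?_⟩,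
      Finset.mem_univ _, ?_⟩
    · intro i j hij
      exact w.injective (congrArg Subtype.val hij)
    · rintro ⟨a, ha⟩
      obtain ⟨i, -, rfl⟩ := Finset.mem_map.1 ha
      exact ⟨i, rfl⟩
    · ext i : 1
      rfl
  · intro π hπ
    have h : Finset.univ.map
        (π.toEmbedding.trans (Function.Embedding.subtype fun a => a ∈ A)) = A := by
      ext a
      simp only [Finset.mem_map, Finset.mem_univ, true_and, Function.Embedding.trans_apply,
        Equiv.coe_toEmbedding, Function.Embedding.subtype_apply]
      exact ⟨by rintro ⟨i, rfl⟩; exact (π i).2, fun ha => ⟨π.symm ⟨a, ha⟩, by simp⟩⟩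
    rw [h]
    rfl

/-! ### Symmetry under reversal. -/

/-- Reindexing by `e` replaces each exponent by its complement in the constant total, which factors
out. -/
theorem sum_pow_eq_mul_sum_inv_pow {ι R : Type*} [Fintype ι] [CommRing R] (e : ι ≃ ι)
    (a b : ι → ℕ) (N E : ℤ) (ha : ∀ i, (a i : ℤ) + a (e i) = N)
    (hb : ∀ i, (b i : ℤ) + b (e i) = E) (t q : Rˣ) :
    ∑ i, (t : R) ^ a i * (q : R) ^ b i =
      ((t ^ N * q ^ E : Rˣ) : R) *
        ∑ i, ((t⁻¹ : Rˣ) : R) ^ a i * ((q⁻¹ : Rˣ) : R) ^ b i := by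
  rw [Finset.mul_sum, ← e.sum_comp]
  refine Finset.sum_congr rfl fun i _ => ?_
  have h : t ^ a (e i) * q ^ b (e i) = t ^ N * q ^ E * (t⁻¹ ^ a i * q⁻¹ ^ b i) := by
    rw [← ha i, ← hb i, zpow_add, zpow_add]
    simp only [zpow_natCast, inv_pow]
    rw [mul_mul_mul_comm, mul_inv_cancel_comm, mul_inv_cancel_comm]
  simpa using congrArg Units.val h

theorem wordDes_add_rev {n d : ℕ} (w : Fin (d + 1) ↪ Fin n) :
    wordDes w + wordDes (w.trans Fin.revPerm.toEmbedding) = d := by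
  simpa [wordDes] using sum_wordDescents_add_rev w fun _ => 1

theorem wordMaj_add_rev {n d : ℕ} (w : Fin (d + 1) ↪ Fin n) :
    2 * (wordMaj w + wordMaj (w.trans Fin.revPerm.toEmbedding)) = d * (d + 1) := by
  rw [wordMaj, wordMaj, sum_wordDescents_add_rev w fun i => i + 1]
  have h := Finset.sum_range_id_mul_two (d + 1)
  rw [Finset.sum_range_succ'] at h
  simp only [add_zero, Nat.add_sub_cancel] at h
  rw [mul_comm, h, mul_comm]

end QHPoly

/-- Permutations `π` of `A` are words `π 0, …, π (n - k)`, that is, bijections from the positions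
onto `A`.  The second part is an identity of Laurent polynomials, stated as an identity for all
invertible elements `t`, `q` of all commutative rings; the exponent of `q` is an exact quotient. -/
theorem mainTheorem3 (n k : ℕ) (hk : 2 ≤ k) (hkn : k ≤ n)
    (y : Finset (Fin n) → ℝ) (hy : ∀ I ∈ (QHPoly.invariantBuildingSet n k).sets, 0 < y I) :
    QHPoly.qhPoly (QHPoly.nestohedron (QHPoly.invariantBuildingSet n k) y) =
        ∑ A ∈ Finset.powersetCard (n - k + 1) (Finset.univ : Finset (Fin n)),
          ∑ π : Fin (n - k + 1) ≃ {a : Fin n // a ∈ A},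
            MvPolynomial.X 0 ^ (QHPoly.wordDes (fun i => (π i : Fin n)) +
                QHPoly.numLarger A (π 0)) *
              MvPolynomial.X 1 ^ (QHPoly.wordMaj (fun i => (π i : Fin n)) +
                QHPoly.wordDes (fun i => (π i : Fin n)) + QHPoly.numLarger A (π 0)) ∧
      ∀ (R : Type*) [CommRing R] (t q : Rˣ),
        MvPolynomial.aeval ![(t : R), (q : R)]
            (QHPoly.qhPoly (QHPoly.nestohedron (QHPoly.invariantBuildingSet n k) y)) =
          ((t ^ ((n : ℤ) - 1) *
              q ^ (((k : ℤ) ^ 2 - 2 * k * n - k + (n : ℤ) ^ 2 + 3 * n - 2) / 2) : Rˣ) : R) *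
            MvPolynomial.aeval ![((t⁻¹ : Rˣ) : R), ((q⁻¹ : Rˣ) : R)]
              (QHPoly.qhPoly (QHPoly.nestohedron (QHPoly.invariantBuildingSet n k) y)) := by
  classical
  obtain ⟨d, rfl⟩ : ∃ d, n = d + k := ⟨n - k, by omega⟩
  have hd : d + k - k = d := by omega
  rw [hd, QHPoly.qhPoly_nestohedron hk rfl hy]
  refine ⟨?_, fun R _ t q => ?_⟩
  · exact (QHPoly.sum_powersetCard_sum_equiv fun A w =>
      (MvPolynomial.X 0 ^ (QHPoly.wordDes w + QHPoly.numLarger A (w 0)) *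
        MvPolynomial.X 1 ^ (QHPoly.wordMaj w + QHPoly.wordDes w + QHPoly.numLarger A (w 0)) :
          MvPolynomial (Fin 2) ℤ)).symm
  · simp only [map_sum, map_mul, map_pow, MvPolynomial.aeval_X, Matrix.cons_val_zero,
      Matrix.cons_val_one]
    refine QHPoly.sum_pow_eq_mul_sum_inv_pow
      (Equiv.embeddingCongr (Equiv.refl _) Fin.revPerm) _ _ _ _ (fun w => ?_) (fun w => ?_) t q
    all_goals
      have he : Equiv.embeddingCongr (Equiv.refl _) Fin.revPerm w =
        w.trans Fin.revPerm.toEmbedding := rfl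
      have h1 := QHPoly.wordDes_add_rev w
      have h2 := QHPoly.wordMaj_add_rev w
      have h3 := QHPoly.numLarger_add_rev w
      rw [show d + k - (d + 1) = k - 1 by omega] at h3
      rw [he]
      generalize w.trans Fin.revPerm.toEmbedding = w' at h1 h2 h3 ⊢
      zify [show 1 ≤ k by omega] at h1 h2 h3
    · push_cast
      linear_combination h1 + h3
    -- With `n = d + k` the numerator equals `d * (d + 1) + 2 * d + 2 * (k - 1)`, twice the total of
    -- the exponents of `q`, so the division is exact.
    · symm
      refine Int.ediv_eq_of_eq_mul_left two_ne_zero ?_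
      push_cast
      linear_combination -h2 - 2 * h1 - 2 * h3
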